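/- Let $\mu$ be an infinitely divisible probability measure on $\mathbb{R}$ that is not a point mass, and let $(\mu_t)_{t\ge 0}$ be the associated convolution semigroup of probability measures on $\mathbb{R}$: $\mu_1=\mu$, $\mu_0=\delta_0$, $\mu_s*\mu_t=\mu_{s+t}$ for $s,t\ge 0$, and $\mu_t\to\mu_s$ weakly as $t\downarrow s$, for every $s \ge 0$. Let $d\ge 2$, let $\Lambda$ be Lebesgue measure on $\mathbb{R}^d$, and let $\mathcal{C}$ be the collection of Borel sets $B\subseteq\mathbb{R}^d$ with $\Lambda(B)<\infty$. Let $\Pi=(\Pi(B))_{B\in\mathcal{C}}$ be a Lévy noise corresponding to $\mu$, that is, a family of real random variables on a probability space $(\Omega,\mathcal{F},\mathbb{P})$ such that $\Pi(B)$ has distribution $\mu_{\Lambda(B)}$ for each $B\in\mathcal{C}$ and, for pairwise disjoint $B_1,\dots,B_n\in\mathcal{C}$, the random variables $\Pi(B_1),\dots,\Pi(B_n)$ are independent and $\Pi(B_1\cup\dots\cup B_n)=\Pi(B_1)+\dots+\Pi(B_n)$ almost surely. Let $\Sigma=\mathbb{R}^{\mathcal{C}}$ with its product $\sigma$-field $\mathcal{S}$,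 and let $\Gamma$ be the topological group of linear maps $g:\mathbb{R}^d\to\mathbb{R}^d$ with $|\det g|=1$. For $g\in\Gamma$ let $T_g:\Sigma\to\Sigma$ be the map $(\pi(B))_{B\in\mathcal{C}}\mapsto(\pi(g^{-1}B))_{B\in\mathcal{C}}$. For a subgroup $G$ of $\Gamma$ the invariant $\sigma$-field $\mathcal{I}_G$ consists of all $S\in\mathcal{S}$ such that $\mathbb{P}(\{\Pi\in S\}\,\triangle\,\{T_g\Pi\in S\})=0$ for all $g\in G$. Then, for every closed subgroup $G$ of $\Gamma$, the following are equivalent: (i) $\mathbb{P}\{\Pi\in S\}\in\{0,1\}$ for every $S\in\mathcal{I}_G$; (ii) $G$ is not compact. -/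

import Mathlib

open MeasureTheory ProbabilityTheory Filter Topology
open scoped NNReal ENNReal

namespace LevyNoise

/-- A probability measure `μ` on `ℝ` is infinitely divisible if for every `n ≥ 1` it is the `n`-fold
convolution power of some probability measure. -/
def IsInfinitelyDivisible (μ : Measure ℝ) : Prop :=
  ∀ n : ℕ, 1 ≤ n → ∃ ν : Measure ℝ, IsProbabilityMeasure ν ∧
    (fun ρ : Measure ℝ => ρ.conv ν)^[n] (Measure.dirac 0) = μ

/-- `κ` is the convolution semigroup `(μ_t)_{t ≥ 0}` of probability measures on `ℝ` associated with
`μ`. The topology on `ProbabilityMeasure ℝ` is that of weak convergence. -/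
structure IsConvolutionSemigroup (μ : Measure ℝ) (κ : ℝ≥0 → ProbabilityMeasure ℝ) : Prop where
  one : (κ 1 : Measure ℝ) = μ
  zero : (κ 0 : Measure ℝ) = Measure.dirac 0
  conv : ∀ s t : ℝ≥0, (κ s : Measure ℝ).conv (κ t : Measure ℝ) = (κ (s + t) : Measure ℝ)
  rightCts : ∀ s : ℝ≥0, Tendsto κ (𝓝[>] s) (𝓝 (κ s))

/-- The Borel subsets of `ℝ^d` of finite Lebesgue measure. -/
abbrev FinVolSet (d : ℕ) : Type :=
  {B : Set (Fin d → ℝ) // MeasurableSet B ∧ volume B < ∞}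

/-- The union of a finite family of Borel sets of finite Lebesgue measure. -/
def FinVolSet.iUnion {d n : ℕ} (B : Fin n → FinVolSet d) : FinVolSet d :=
  ⟨⋃ i, (B i : Set (Fin d → ℝ)), MeasurableSet.iUnion fun i => (B i).2.1,
    (measure_iUnion_fintype_le volume _).trans_lt
      (ENNReal.sum_lt_top.2 fun i _ => (B i).2.2)⟩

/-- `X = (X(B))_B`, indexed by the Borel sets of finite Lebesgue measure, is a Lévy noise on `ℝ^d`
corresponding to `μ`, on the probability space `(Ω, P)`. -/
structure IsLevyNoise {Ω : Type*} [MeasurableSpace Ω] (d : ℕ) (μ : Measure ℝ) (P : Measure Ω)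
    (X : FinVolSet d → Ω → ℝ) : Prop where
  measurable : ∀ B, Measurable (X B)
  law : ∃ κ : ℝ≥0 → ProbabilityMeasure ℝ, IsConvolutionSemigroup μ κ ∧
    ∀ B : FinVolSet d, P.map (X B) = (κ (volume (B : Set (Fin d → ℝ))).toNNReal : Measure ℝ)
  indep : ∀ (n : ℕ) (B : Fin n → FinVolSet d),
    Pairwise (fun i j => Disjoint (B i : Set (Fin d → ℝ)) (B j)) →
      iIndepFun (fun i => X (B i)) P
  additive : ∀ (n : ℕ) (B : Fin n → FinVolSet d),
    Pairwise (fun i j => Disjoint (B i : Set (Fin d → ℝ)) (B j)) →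
      X (FinVolSet.iUnion B) =ᵐ[P] fun ω => ∑ i, X (B i) ω

/-- The group `Γ` of invertible real `d × d` matrices whose determinant has absolute value `1`,
with the topology inherited from `GL (Fin d) ℝ`. -/
def Gam (d : ℕ) : Subgroup (GL (Fin d) ℝ) where
  carrier := {g | |(g : Matrix (Fin d) (Fin d) ℝ).det| = 1}
  mul_mem' := by
    intro a b ha hb
    simp only [Set.mem_ofPred_eq] at ha hb ⊢
    rw [Units.val_mul, Matrix.det_mul, abs_mul, ha, hb, one_mul]
  one_mem' := by simp
  inv_mem' := by
    intro a ha
    simp only [Set.mem_ofPred_eq] at ha ⊢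
    have h : (a : Matrix (Fin d) (Fin d) ℝ).det *
        ((a⁻¹ : GL (Fin d) ℝ) : Matrix (Fin d) (Fin d) ℝ).det = 1 := by
      rw [← Matrix.det_mul, ← Units.val_mul, mul_inv_cancel, Units.val_one, Matrix.det_one]
    have h2 := congrArg abs h
    rwa [abs_mul, ha, one_mul, abs_one] at h2

/-- The linear map of `ℝ^d` given by the matrix `g`. -/
def act {d : ℕ} (g : Gam d) (x : Fin d → ℝ) : Fin d → ℝ :=
  Matrix.mulVec ((g : GL (Fin d) ℝ) : Matrix (Fin d) (Fin d) ℝ) x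

theorem measurePreserving_act {d : ℕ} (g : Gam d) :
    MeasurePreserving (act g) (volume : Measure (Fin d → ℝ)) volume := by
  have hg : |((g : GL (Fin d) ℝ) : Matrix (Fin d) (Fin d) ℝ).det| = 1 := g.2
  have h0 : ((g : GL (Fin d) ℝ) : Matrix (Fin d) (Fin d) ℝ).det ≠ 0 := by
    intro h
    rw [h, abs_zero] at hg
    exact zero_ne_one hg
  have h := Real.map_matrix_volume_pi_eq_smul_volume_pi h0
  rw [abs_inv, hg, inv_one, ENNReal.ofReal_one, one_smul] at h
  have he : (act g) = ⇑(Matrix.toLin' ((g : GL (Fin d) ℝ) : Matrix (Fin d) (Fin d) ℝ)) := by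
    funext x
    simp [act]
  refine ⟨?_, ?_⟩
  · rw [he]
    exact (LinearMap.continuous_of_finiteDimensional _).measurable
  · rw [he]
    exact h

/-- The set `g⁻¹ B`, written as the preimage of `B` under `g`. -/
def FinVolSet.invImage {d : ℕ} (g : Gam d) (B : FinVolSet d) : FinVolSet d :=
  ⟨act g ⁻¹' (B : Set (Fin d → ℝ)), (measurePreserving_act g).measurable B.2.1, by
    rw [(measurePreserving_act g).measure_preimage B.2.1.nullMeasurableSet]
    exact B.2.2⟩

/-- The space `Σ` of all real functions on the Borel sets of finite Lebesgue measure; its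
measurable structure is the product `σ`-field. -/
abbrev Config (d : ℕ) : Type := FinVolSet d → ℝ

/-- The map `T_g : Σ → Σ`, `(π(B))_B ↦ (π(g⁻¹ B))_B`. -/
def T {d : ℕ} (g : Gam d) (π : Config d) : Config d :=
  fun B => π (FinVolSet.invImage g B)

/-- The random element `ω ↦ (X(B)(ω))_B` of `Σ`. -/
def path {Ω : Type*} {d : ℕ} (X : FinVolSet d → Ω → ℝ) (ω : Ω) : Config d :=
  fun B => X B ω

/-- The invariant `σ`-field `I_G`: the measurable sets `S ⊆ Σ` with
`P({X ∈ S} ∆ {T_g X ∈ S}) = 0` for all `g ∈ G`. -/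
@[reducible] def invariantSigmaField {Ω : Type*} [MeasurableSpace Ω] {d : ℕ} (P : Measure Ω)
    (X : FinVolSet d → Ω → ℝ) (G : Subgroup (Gam d)) : MeasurableSpace (Config d) where
  MeasurableSet' S := MeasurableSet S ∧ ∀ g ∈ G,
    P (symmDiff {ω | path X ω ∈ S} {ω | T g (path X ω) ∈ S}) = 0
  measurableSet_empty := ⟨MeasurableSet.empty, fun g _ => by simp⟩
  measurableSet_compl := by
    rintro S ⟨hS, h⟩
    refine ⟨hS.compl, fun g hg => ?_⟩
    have h1 := measure_symmDiff_eq_zero_iff.1 (h g hg)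
    exact measure_symmDiff_eq_zero_iff.2 h1.compl
  measurableSet_iUnion := by
    intro S hS
    refine ⟨MeasurableSet.iUnion fun i => (hS i).1, fun g hg => ?_⟩
    have h1 := Filter.EventuallyEq.countable_iUnion
      fun i => measure_symmDiff_eq_zero_iff.1 ((hS i).2 g hg)
    have e1 : {ω | path X ω ∈ ⋃ i, S i} = ⋃ i, {ω | path X ω ∈ S i} := by
      ext ω
      simp
    have e2 : {ω | T g (path X ω) ∈ ⋃ i, S i} = ⋃ i, {ω | T g (path X ω) ∈ S i} := by
      ext ω
      simp
    rw [measure_symmDiff_eq_zero_iff, e1, e2]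
    exact h1

end LevyNoise

/-!
The action of `G` is mixing along some sequence when `G` is not compact, and it fixes the noise of
some set when `G` is compact.

If `G` is closed and not compact, its matrix entries are unbounded
(`isCompact_of_entries_bounded`). A matrix `g` with a large entry moves most of any set `U` of finite
volume off itself: up to a small error `U` is bounded, and the points `x` of a ball for which `g x`
lies in the same ball form a thin slab (`exists_volume_preimage_inter_le`). The noise of the small
overlap of `g⁻¹ U` and `U` is close to `0` in probability, by continuity of the convolution semigroup
at `0`, and without the overlap the noises of subsets of `U` and of `g⁻¹ U` are independent. Hence
`f(X)` and `f(T_g X)` are nearly uncorrelated for every `f` with values in `[0, 1]` that is a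
uniformly continuous function of finitely many coordinates
(`IsLevyNoise.exists_abs_integral_mul_sub_le`). Such `f` approximate the indicator of any measurable
`S ⊆ Σ` in `L¹` (`isApproximable_of_measurableSet`), and `T_g X` has the same law as `X`
(`IsLevyNoise.map_T_path_eq`). For an invariant `S` with probability `p` this gives
`p = P(X ∈ S, T_g X ∈ S) ≈ p²`, so that `p` is `0` or `1`.

If `G` is compact, the union `B` of the `G`-translates of the unit cube is compact and invariant, so
that events about `X(B)` belong to `I_G`. The law of `X(B)` is `μ_t` with `t ≥ 1`. As
`μ_t = μ * μ_{t-1}` and `μ` is not a point mass, neither is `μ_t`, and some event about `X(B)` has a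
probability other than `0` and `1`.
-/

/-! ### Non-compact groups of volume-preserving linear maps move sets off themselves -/

namespace LevyNoise

theorem isClosed_gam (d : ℕ) : IsClosed (Gam d : Set (GL (Fin d) ℝ)) :=
  isClosed_eq (Units.continuous_val.matrix_det.abs) continuous_const

theorem act_mul {d : ℕ} (g h : Gam d) (x : Fin d → ℝ) : act (g * h) x = act g (act h x) := by
  simp [act, Matrix.mulVec_mulVec]

theorem act_one {d : ℕ} (x : Fin d → ℝ) : act (1 : Gam d) x = x := by
  simp [act]

/-- A closed subgroup with uniformly bounded matrix entries is compact: the entries of inverses are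
entries of group elements too, so that the group is bounded in the topology of units. -/
theorem isCompact_of_entries_bounded {d : ℕ} {G : Subgroup (Gam d)}
    (hG : IsClosed (G : Set (Gam d))) {M : ℝ}
    (hM : ∀ g ∈ G, ∀ i j, |((g : GL (Fin d) ℝ) : Matrix (Fin d) (Fin d) ℝ) i j| ≤ M) :
    IsCompact (G : Set (Gam d)) := by
  let K : Set (Matrix (Fin d) (Fin d) ℝ) := {A | ∀ i j, A i j ∈ Set.Icc (-M) M}
  have hK : IsCompact K := by
    have : K = Set.pi Set.univ fun _ => Set.pi Set.univ fun _ => Set.Icc (-M) M := by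
      ext A
      exact ⟨fun h i _ j _ => h i j, fun h i j => h i trivial j trivial⟩
    rw [this]
    exact isCompact_univ_pi fun _ => isCompact_univ_pi fun _ => isCompact_Icc
  have hK2 : IsCompact (K ×ˢ (MulOpposite.unop ⁻¹' K)) :=
    hK.prod (MulOpposite.opHomeomorph.symm.isCompact_preimage.mpr hK)
  have hC := (Units.isClosedEmbedding_embedProduct
    (α := Matrix (Fin d) (Fin d) ℝ)).isCompact_preimage hK2
  rw [Subtype.isCompact_iff]
  refine hC.of_isClosed_subset ((isClosed_gam d).isClosedEmbedding_subtypeVal.isClosedMap _ hG) ?_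
  rintro _ ⟨g, hg, rfl⟩
  refine ⟨fun i j => abs_le.1 (hM g hg i j), fun i j => abs_le.1 ?_⟩
  exact hM g⁻¹ (G.inv_mem hg) i j

/-- If `g` has a nonzero entry in row `i` and column `j`, then replacing the `j`-th coordinate of `x`
by the `i`-th coordinate of `g x` is a linear map of determinant `g i j` that takes
`g⁻¹ K ∩ K` into `K`, the cube of side `2 R`. -/
theorem volume_preimage_closedBall_inter_le {d : ℕ} (g : Gam d) (i j : Fin d) (R : ℝ)
    (hg : ((g : GL (Fin d) ℝ) : Matrix (Fin d) (Fin d) ℝ) i j ≠ 0) :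
    volume (act g ⁻¹' Metric.closedBall 0 R ∩ Metric.closedBall 0 R) ≤
      ENNReal.ofReal |((g : GL (Fin d) ℝ) : Matrix (Fin d) (Fin d) ℝ) i j|⁻¹ *
        volume (Metric.closedBall (0 : Fin d → ℝ) R) := by
  set m : Matrix (Fin d) (Fin d) ℝ := ((g : GL (Fin d) ℝ) : Matrix (Fin d) (Fin d) ℝ) with hm
  let A : Matrix (Fin d) (Fin d) ℝ := (1 : Matrix (Fin d) (Fin d) ℝ).updateRow j (m i)
  have hdet : A.det = m i j := by
    rw [← Matrix.cramer_transpose_apply, Matrix.transpose_one, Matrix.cramer_one]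
    rfl
  have hdet' : LinearMap.det (Matrix.toLin' A) = m i j := by
    rw [LinearMap.det_toLin', hdet]
  rw [← abs_inv, ← hdet', ← Measure.addHaar_preimage_linearMap volume (by rwa [hdet'])]
  refine measure_mono ?_
  rintro x ⟨hx1, hx2⟩
  rw [Set.mem_preimage, mem_closedBall_zero_iff] at *
  have hR : 0 ≤ R := (norm_nonneg _).trans hx2
  rw [pi_norm_le_iff_of_nonneg hR] at *
  intro k
  rw [Matrix.toLin'_apply]
  by_cases hk : k = j
  · subst hk
    have : (A.mulVec x) k = act g x i := by
      simp [A, act, Matrix.mulVec, hm]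
    rw [this]
    exact hx1 i
  · have : (A.mulVec x) k = x k := by
      simp [A, Matrix.mulVec, Matrix.updateRow_ne hk, Matrix.one_eq_pi_single]
    rw [this]
    exact hx2 k

/-- Some element of a non-compact closed group makes the overlap of `g⁻¹ U` and `U` small. -/
theorem exists_volume_preimage_inter_le {d : ℕ} {G : Subgroup (Gam d)}
    (hG : IsClosed (G : Set (Gam d))) (hnc : ¬ IsCompact (G : Set (Gam d)))
    {U : Set (Fin d → ℝ)} (hU : MeasurableSet U) (hUfin : volume U < ∞) {ε : ℝ≥0∞} (hε : ε ≠ 0) :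
    ∃ g ∈ G, volume (act g ⁻¹' U ∩ U) ≤ ε := by
  have hε3 : ε / 3 ≠ 0 := by simp [hε]
  obtain ⟨K, hKU, hK, hUK⟩ := hU.exists_isCompact_sdiff_lt hUfin.ne hε3
  obtain ⟨R, hKR⟩ := hK.isBounded.subset_closedBall (0 : Fin d → ℝ)
  have hV : volume (Metric.closedBall (0 : Fin d → ℝ) R) ≠ ∞ := measure_closedBall_lt_top.ne
  obtain ⟨δ, hδ, hδV⟩ : ∃ δ : ℝ, 0 < δ ∧
      ENNReal.ofReal δ * volume (Metric.closedBall (0 : Fin d → ℝ) R) ≤ ε / 3 := by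
    obtain ⟨δ, hδ, h⟩ := ENNReal.exists_nnreal_pos_mul_lt hV hε3
    exact ⟨δ, hδ, by simpa using h.le⟩
  obtain ⟨g, hgG, i, j, hgij⟩ : ∃ g ∈ G, ∃ i j,
      δ⁻¹ < |((g : GL (Fin d) ℝ) : Matrix (Fin d) (Fin d) ℝ) i j| := by
    by_contra! h
    exact hnc (isCompact_of_entries_bounded hG h)
  refine ⟨g, hgG, ?_⟩
  have h0 : 0 < |((g : GL (Fin d) ℝ) : Matrix (Fin d) (Fin d) ℝ) i j| :=
    (inv_pos.2 hδ).trans hgij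
  have hball := (volume_preimage_closedBall_inter_le g i j R (abs_pos.1 h0)).trans
    ((mul_le_mul_left (ENNReal.ofReal_le_ofReal
      (inv_le_of_inv_le₀ hδ hgij.le)) _).trans hδV)
  have hpre : volume (act g ⁻¹' (U \ K)) ≤ ε / 3 := by
    rw [(measurePreserving_act g).measure_preimage (hU.diff hK.measurableSet).nullMeasurableSet]
    exact hUK.le
  have hsub : act g ⁻¹' U ∩ U ⊆ (act g ⁻¹' Metric.closedBall 0 R ∩ Metric.closedBall 0 R) ∪
      (act g ⁻¹' (U \ K) ∪ U \ K) := by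
    rintro x ⟨hx1, hx2⟩
    by_cases h1 : act g x ∈ K
    · by_cases h2 : x ∈ K
      · exact Or.inl ⟨hKR h1, hKR h2⟩
      · exact Or.inr (Or.inr ⟨hx2, h2⟩)
    · exact Or.inr (Or.inl ⟨hx1, h1⟩)
  calc volume (act g ⁻¹' U ∩ U) ≤ _ := measure_mono hsub
    _ ≤ ε / 3 + (ε / 3 + ε / 3) :=
      (measure_union_le _ _).trans (add_le_add hball ((measure_union_le _ _).trans
        (add_le_add hpre hUK.le)))
    _ = ε := by rw [← add_assoc, ENNReal.add_thirds]

/-! ### Invariant sets of compact groups -/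

/-- A compact group has an invariant compact set that contains the unit cube, the union of its
translates. -/
theorem exists_invariant_compact {d : ℕ} {G : Subgroup (Gam d)}
    (hG : IsCompact (G : Set (Gam d))) :
    ∃ B : Set (Fin d → ℝ), IsCompact B ∧ Metric.closedBall 0 1 ⊆ B ∧
      ∀ g ∈ G, act g ⁻¹' B = B := by
  have hcont : Continuous fun p : Gam d × (Fin d → ℝ) => act p.1 p.2 :=
    ((Units.continuous_val.comp continuous_subtype_val).comp continuous_fst).matrix_mulVec
      continuous_snd
  refine ⟨(fun p : Gam d × (Fin d → ℝ) => act p.1 p.2) '' ((G : Set (Gam d)) ×ˢ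
    Metric.closedBall 0 1), (hG.prod (isCompact_closedBall _ _)).image hcont, ?_, ?_⟩
  · exact fun x hx => ⟨(1, x), ⟨G.one_mem, hx⟩, act_one x⟩
  · intro g hg
    ext x
    constructor
    · rintro ⟨⟨h, y⟩, ⟨hh, hy⟩, hxy⟩
      refine ⟨(g⁻¹ * h, y), ⟨G.mul_mem (G.inv_mem hg) hh, hy⟩, ?_⟩
      simp only at hxy ⊢
      rw [act_mul, hxy, ← act_mul, inv_mul_cancel, act_one]
    · rintro ⟨⟨h, y⟩, ⟨hh, hy⟩, rfl⟩
      exact ⟨(g * h, y), ⟨G.mul_mem hg hh, hy⟩, act_mul g h y⟩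

/-! ### Degenerate marginals -/

/-- A factor of a point mass under convolution is a point mass. -/
theorem exists_eq_dirac_of_conv_eq_dirac {μ ν : Measure ℝ} [IsProbabilityMeasure μ]
    [IsProbabilityMeasure ν] {c : ℝ} (h : μ.conv ν = Measure.dirac c) :
    ∃ c' : ℝ, μ = Measure.dirac c' := by
  have h1 : ∀ᵐ z ∂(ν.conv μ), z = c := by
    rw [Measure.conv_comm, h]
    exact ae_eq_dirac (fun z : ℝ => z)
  have h2 : ∀ᵐ p ∂(ν.prod μ), p.1 + p.2 = c :=
    ae_of_ae_map (measurable_fst.add measurable_snd).aemeasurable h1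
  obtain ⟨y, hy⟩ := (Measure.ae_ae_of_ae_prod h2).exists
  refine ⟨c - y, ?_⟩
  have h3 : (id : ℝ → ℝ) =ᵐ[μ] fun _ => c - y := by
    filter_upwards [hy] with x hx
    rw [id, ← hx]
    ring
  simpa using (hasLaw_dirac_of_ae_eq h3).map_eq

/-- If `μ` is not a point mass, neither is `κ t` for `t ≥ 1`, so that it charges some event with a
probability other than `0` and `1`. -/
theorem IsConvolutionSemigroup.exists_nontrivial_event {μ : Measure ℝ} {κ : ℝ≥0 → ProbabilityMeasure ℝ}
    (hκ : IsConvolutionSemigroup μ κ) (hμ : ∀ c : ℝ, μ ≠ Measure.dirac c) {t : ℝ≥0} (ht : 1 ≤ t) :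
    ∃ E : Set ℝ, MeasurableSet E ∧ (κ t : Measure ℝ) E ≠ 0 ∧ (κ t : Measure ℝ) E ≠ 1 := by
  by_contra! h
  have : IsZeroOneMeasure (κ t : Measure ℝ) :=
    ⟨fun s hs => or_iff_not_imp_left.2 (h s hs)⟩
  obtain ⟨c, hc⟩ := IsZeroOneMeasure.exists_eq_dirac (μ := (κ t : Measure ℝ))
  have h1 := hκ.conv 1 (t - 1)
  rw [add_tsub_cancel_of_le ht, hc] at h1
  obtain ⟨c', hc'⟩ := exists_eq_dirac_of_conv_eq_dirac h1
  exact hμ c' (hκ.one ▸ hc')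

/-- The marginals of a convolution semigroup are close to the point mass at `0` for small times. -/
theorem IsConvolutionSemigroup.exists_tail_le {μ : Measure ℝ} {κ : ℝ≥0 → ProbabilityMeasure ℝ}
    (hκ : IsConvolutionSemigroup μ κ) {δ : ℝ} (hδ : 0 < δ) {ε : ℝ≥0∞} (hε : ε ≠ 0) :
    ∃ η : ℝ≥0, 0 < η ∧ ∀ t ≤ η, (κ t : Measure ℝ) {x | δ < |x|} ≤ ε := by
  have hopen : IsOpen {x : ℝ | δ < |x|} := isOpen_lt continuous_const continuous_abs
  have hclosed : IsClosed {x : ℝ | δ ≤ |x|} := isClosed_le continuous_const continuous_abs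
  have h0 : (κ 0 : Measure ℝ) {x | δ ≤ |x|} = 0 := by
    rw [hκ.zero, Measure.dirac_apply' _ hclosed.measurableSet]
    simp [hδ]
  have hlim := ProbabilityMeasure.tendsto_measure_of_null_frontier_of_tendsto' (hκ.rightCts 0)
    (measure_mono_null hclosed.frontier_subset h0)
  rw [h0] at hlim
  have hev := hlim.eventually (ge_mem_nhds (pos_iff_ne_zero.2 hε))
  obtain ⟨u, hu, hu'⟩ := (mem_nhdsGT_iff_exists_Ioc_subset).1 hev
  refine ⟨u, hu, fun t ht => ?_⟩
  have hsub : {x : ℝ | δ < |x|} ⊆ {x | δ ≤ |x|} := fun x (hx : δ < |x|) => hx.le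
  refine (measure_mono hsub).trans ?_
  rcases eq_or_ne t 0 with rfl | h
  · rw [h0]
    exact zero_le
  · exact hu' ⟨pos_iff_ne_zero.2 h, ht⟩

/-! ### Finite-dimensional distributions of a Lévy noise -/

/-- Finitely many sets are unions of the cells of a finite partition; the cell indexed by `s`
consists of the points that lie in exactly those sets whose index is in `s`. -/
theorem exists_common_refinement {d : ℕ} {ι : Type*} [Fintype ι] (B : ι → FinVolSet d) :
    ∃ A : Finset ι → FinVolSet d,
      Pairwise (fun s t => Disjoint (A s : Set (Fin d → ℝ)) (A t)) ∧
      (∀ s, (A s : Set (Fin d → ℝ)) ⊆ ⋃ k, (B k : Set (Fin d → ℝ))) ∧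
      ∀ k, (B k : Set (Fin d → ℝ)) = ⋃ s : {s : Finset ι // k ∈ s}, (A s : Set (Fin d → ℝ)) := by
  let c : Finset ι → Set (Fin d → ℝ) := fun s =>
    (⋃ k, (B k : Set (Fin d → ℝ))) ∩ {x | ∀ k, x ∈ (B k : Set (Fin d → ℝ)) ↔ k ∈ s}
  have hc : ∀ s, MeasurableSet (c s) := fun s =>
    (MeasurableSet.iUnion fun k => (B k).2.1).inter (Measurable.setOf (Measurable.forall fun k =>
      (measurable_mem.2 (B k).2.1).iff measurable_const))
  have hfin : ∀ s, volume (c s) < ∞ := fun s =>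
    (measure_mono Set.inter_subset_left).trans_lt ((measure_iUnion_fintype_le volume _).trans_lt
      (ENNReal.sum_lt_top.2 fun k _ => (B k).2.2))
  refine ⟨fun s => ⟨c s, hc s, hfin s⟩, ?_, fun s => Set.inter_subset_left, fun k => ?_⟩
  · intro s t hst
    refine Set.disjoint_left.2 fun x hxs hxt => hst ?_
    ext k
    exact (hxs.2 k).symm.trans (hxt.2 k)
  · classical
    ext x
    constructor
    · intro hx
      refine Set.mem_iUnion.2 ⟨⟨Finset.univ.filter fun k => x ∈ (B k : Set (Fin d → ℝ)),
        by simpa using hx⟩, Set.mem_iUnion.2 ⟨k, hx⟩, fun l => by simp⟩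
    · intro hx
      obtain ⟨⟨s, hs⟩, hxs⟩ := Set.mem_iUnion.1 hx
      exact (hxs.2 k).2 hs

section Noise

variable {Ω : Type*} [MeasurableSpace Ω] {d : ℕ} {μ : Measure ℝ} {P : Measure Ω}
  {X : FinVolSet d → Ω → ℝ}

theorem IsLevyNoise.iIndepFun_of_disjoint (hX : IsLevyNoise d μ P X) {ι : Type*} [Fintype ι]
    {A : ι → FinVolSet d}
    (hA : Pairwise (fun s t => Disjoint (A s : Set (Fin d → ℝ)) (A t))) :
    iIndepFun (fun i => X (A i)) P := by
  let e := (Fintype.equivFin ι).symm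
  exact (iIndepFun_precomp_of_bijective e.bijective).1
    (hX.indep _ (fun i => A (e i)) fun i j hij => hA (e.injective.ne hij))

theorem IsLevyNoise.ae_eq_sum (hX : IsLevyNoise d μ P X) {ι : Type*} [Fintype ι]
    {A : ι → FinVolSet d}
    (hA : Pairwise (fun s t => Disjoint (A s : Set (Fin d → ℝ)) (A t))) {B : FinVolSet d}
    (hB : (B : Set (Fin d → ℝ)) = ⋃ i, (A i : Set (Fin d → ℝ))) :
    X B =ᵐ[P] fun ω => ∑ i, X (A i) ω := by
  let e := (Fintype.equivFin ι).symm
  have h := hX.additive _ (fun i => A (e i)) fun i j hij => hA (e.injective.ne hij)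
  have hU : FinVolSet.iUnion (fun i => A (e i)) = B :=
    Subtype.ext ((e.surjective.iUnion_comp fun i => (A i : Set (Fin d → ℝ))).trans hB.symm)
  rw [hU] at h
  filter_upwards [h] with ω hω
  rw [hω]
  exact e.sum_comp fun i => X (A i) ω

/-- The noise of the sets `B k` is a fixed measurable function of the noise of the cells. -/
theorem IsLevyNoise.ae_eq_sum_cells (hX : IsLevyNoise d μ P X) {ι : Type*} [Fintype ι]
    [DecidableEq ι]
    {B : ι → FinVolSet d} {A : Finset ι → FinVolSet d}
    (hA : Pairwise (fun s t => Disjoint (A s : Set (Fin d → ℝ)) (A t)))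
    (hB : ∀ k, (B k : Set (Fin d → ℝ)) =
      ⋃ s : {s : Finset ι // k ∈ s}, (A s : Set (Fin d → ℝ))) :
    (fun ω k => X (B k) ω) =ᵐ[P]
      fun ω k => ∑ s : {s : Finset ι // k ∈ s}, X (A s) ω := by
  have h : ∀ k, X (B k) =ᵐ[P] fun ω => ∑ s : {s : Finset ι // k ∈ s}, X (A s) ω := fun k =>
    hX.ae_eq_sum (fun s t hst => hA fun h => hst (Subtype.ext h)) (hB k)
  filter_upwards [ae_all_iff.2 h] with ω hω
  exact funext hω

theorem IsLevyNoise.map_eq_pi [IsProbabilityMeasure P] (hX : IsLevyNoise d μ P X)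
    {κ : ℝ≥0 → ProbabilityMeasure ℝ}
    (hκ : ∀ B : FinVolSet d, P.map (X B) = (κ (volume (B : Set (Fin d → ℝ))).toNNReal : Measure ℝ))
    {ι : Type*} [Fintype ι] {A : ι → FinVolSet d}
    (hA : Pairwise (fun s t => Disjoint (A s : Set (Fin d → ℝ)) (A t))) :
    P.map (fun ω i => X (A i) ω) =
      Measure.pi fun i => (κ (volume (A i : Set (Fin d → ℝ))).toNNReal : Measure ℝ) := by
  rw [(iIndepFun_iff_map_fun_eq_pi_map fun i => (hX.measurable _).aemeasurable).1
    (hX.iIndepFun_of_disjoint hA)]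
  simp only [hκ]

theorem IsLevyNoise.map_invImage_eq [IsProbabilityMeasure P] (hX : IsLevyNoise d μ P X)
    (g : Gam d) {ι : Type*} [Fintype ι] (B : ι → FinVolSet d) :
    P.map (fun ω k => X (FinVolSet.invImage g (B k)) ω) = P.map (fun ω k => X (B k) ω) := by
  classical
  obtain ⟨κ, -, hκ⟩ := hX.law
  obtain ⟨A, hA, -, hB⟩ := exists_common_refinement B
  have hA' : Pairwise (fun s t => Disjoint (FinVolSet.invImage g (A s) : Set (Fin d → ℝ))
      (FinVolSet.invImage g (A t))) := fun s t hst => (hA hst).preimage _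
  have hB' : ∀ k, (FinVolSet.invImage g (B k) : Set (Fin d → ℝ)) =
      ⋃ s : {s : Finset ι // k ∈ s}, (FinVolSet.invImage g (A s) : Set (Fin d → ℝ)) := by
    intro k
    simp only [FinVolSet.invImage, hB k, Set.preimage_iUnion]
  let φ : (Finset ι → ℝ) → ι → ℝ := fun y k => ∑ s : {s : Finset ι // k ∈ s}, y s
  have hφ : Measurable φ := by fun_prop
  have hm : ∀ C : Finset ι → FinVolSet d, Measurable fun ω s => X (C s) ω := fun C =>
    measurable_pi_lambda _ fun s => hX.measurable _
  have key : ∀ C : Finset ι → FinVolSet d,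
      P.map (fun ω k => ∑ s : {s : Finset ι // k ∈ s}, X (C s) ω) =
        (P.map fun ω s => X (C s) ω).map φ := fun C => (Measure.map_map hφ (hm C)).symm
  have hvol : ∀ C : FinVolSet d, volume (FinVolSet.invImage g C : Set (Fin d → ℝ)) =
      volume (C : Set (Fin d → ℝ)) := fun C =>
    (measurePreserving_act g).measure_preimage C.2.1.nullMeasurableSet
  rw [Measure.map_congr (hX.ae_eq_sum_cells hA hB), Measure.map_congr (hX.ae_eq_sum_cells hA' hB'),
    key A, key fun s => FinVolSet.invImage g (A s), hX.map_eq_pi hκ hA, hX.map_eq_pi hκ hA']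
  simp only [hvol]

/-- The law of the noise on `Σ` is invariant under every volume-preserving linear map. -/
theorem IsLevyNoise.map_T_path_eq [IsProbabilityMeasure P] (hX : IsLevyNoise d μ P X)
    (g : Gam d) : P.map (fun ω => T g (path X ω)) = P.map (path X) := by
  have hm : Measurable (path X) := measurable_pi_lambda _ fun B => hX.measurable B
  have hm' : Measurable fun ω => T g (path X ω) := measurable_pi_lambda _ fun B => hX.measurable _
  have hr : ∀ I : Finset (FinVolSet d), Measurable (I.restrict (π := fun _ => ℝ)) := fun I =>
    measurable_pi_lambda _ fun _ => measurable_pi_apply _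
  have : IsProbabilityMeasure (P.map (path X)) := Measure.isProbabilityMeasure_map hm.aemeasurable
  refine IsProjectiveLimit.unique
    (P := fun I : Finset (FinVolSet d) => (P.map (path X)).map I.restrict) (fun I => ?_)
    fun I => rfl
  beta_reduce
  rw [Measure.map_map (hr I) hm', Measure.map_map (hr I) hm]
  exact hX.map_invImage_eq g fun B : I => (B : FinVolSet d)

/-- The noises of two finite families that live on disjoint regions are independent. -/
theorem IsLevyNoise.indepFun_of_disjoint (hX : IsLevyNoise d μ P X) {ι ι' : Type*} [Fintype ι]
    [Fintype ι'] (B : ι → FinVolSet d) (C : ι' → FinVolSet d)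
    (h : ∀ k l, Disjoint (B k : Set (Fin d → ℝ)) (C l)) :
    IndepFun (fun ω k => X (B k) ω) (fun ω l => X (C l) ω) P := by
  classical
  obtain ⟨A, hA, hAB, hB⟩ := exists_common_refinement B
  obtain ⟨A', hA', hAC, hC⟩ := exists_common_refinement C
  have hcross : ∀ s t, Disjoint (A s : Set (Fin d → ℝ)) (A' t) := fun s t =>
    (Set.disjoint_iUnion_left.2 fun k => Set.disjoint_iUnion_right.2 fun l => h k l).mono
      (hAB s) (hAC t)
  let D : Finset ι ⊕ Finset ι' → FinVolSet d := Sum.elim A A'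
  have hD : Pairwise (fun s t => Disjoint (D s : Set (Fin d → ℝ)) (D t)) := by
    rintro (s | s) (t | t) hst
    · exact hA fun e => hst (congrArg _ e)
    · exact hcross s t
    · exact (hcross t s).symm
    · exact hA' fun e => hst (congrArg _ e)
  let S : Finset (Finset ι ⊕ Finset ι') := Finset.univ.map .inl
  let S' : Finset (Finset ι ⊕ Finset ι') := Finset.univ.map .inr
  have hS : ∀ s, Sum.inl s ∈ S := fun s => by simp [S]
  have hS' : ∀ s, Sum.inr s ∈ S' := fun s => by simp [S']
  have hdis : Disjoint S S' := by
    rw [Finset.disjoint_left]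
    rintro (s | s) <;> simp [S, S']
  have hind := (hX.iIndepFun_of_disjoint hD).indepFun_finset S S' hdis fun i => hX.measurable _
  let φ : (S → ℝ) → ι → ℝ := fun y k => ∑ s : {s : Finset ι // k ∈ s}, y ⟨_, hS s⟩
  let φ' : (S' → ℝ) → ι' → ℝ := fun y k => ∑ s : {s : Finset ι' // k ∈ s}, y ⟨_, hS' s⟩
  have hφ : Measurable φ := by fun_prop
  have hφ' : Measurable φ' := by fun_prop
  exact (hind.comp hφ hφ').congr (hX.ae_eq_sum_cells hA hB).symm (hX.ae_eq_sum_cells hA' hC).symm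

end Noise

/-! ### Approximation by uniformly continuous cylinder functions -/

section UnitInterval

variable {Ω : Type*} [MeasurableSpace Ω] {P : Measure Ω} [IsProbabilityMeasure P]

theorem integrable_of_mem_Icc {u : Ω → ℝ} (hu : Measurable u) (hu1 : ∀ ω, u ω ∈ Set.Icc (0 : ℝ) 1) :
    Integrable u P :=
  Integrable.of_bound hu.aestronglyMeasurable 1 (ae_of_all _ fun ω => by
    rw [Real.norm_eq_abs, abs_of_nonneg (hu1 ω).1]
    exact (hu1 ω).2)

theorem abs_integral_mul_sub_le {u v u' v' : Ω → ℝ} (hu : Measurable u) (hv : Measurable v)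
    (hu' : Measurable u') (hv' : Measurable v') (hu1 : ∀ ω, u ω ∈ Set.Icc (0 : ℝ) 1)
    (hv1 : ∀ ω, v ω ∈ Set.Icc (0 : ℝ) 1) (hu1' : ∀ ω, u' ω ∈ Set.Icc (0 : ℝ) 1)
    (hv1' : ∀ ω, v' ω ∈ Set.Icc (0 : ℝ) 1) :
    |∫ ω, u ω * v ω ∂P - ∫ ω, u' ω * v' ω ∂P| ≤
      ∫ ω, |u ω - u' ω| ∂P + ∫ ω, |v ω - v' ω| ∂P := by
  have iu : Integrable (fun ω => |u ω - u' ω|) P :=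
    ((integrable_of_mem_Icc hu hu1).sub (integrable_of_mem_Icc hu' hu1')).abs
  have iv : Integrable (fun ω => |v ω - v' ω|) P :=
    ((integrable_of_mem_Icc hv hv1).sub (integrable_of_mem_Icc hv' hv1')).abs
  have i1 : Integrable (fun ω => u ω * v ω) P := integrable_of_mem_Icc (hu.mul hv) fun ω =>
    ⟨mul_nonneg (hu1 ω).1 (hv1 ω).1, mul_le_one₀ (hu1 ω).2 (hv1 ω).1 (hv1 ω).2⟩
  have i2 : Integrable (fun ω => u' ω * v' ω) P := integrable_of_mem_Icc (hu'.mul hv') fun ω =>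
    ⟨mul_nonneg (hu1' ω).1 (hv1' ω).1, mul_le_one₀ (hu1' ω).2 (hv1' ω).1 (hv1' ω).2⟩
  rw [← integral_sub i1 i2, ← integral_add iu iv]
  refine (abs_integral_le_integral_abs).trans (integral_mono (i1.sub i2).abs (iu.add iv) fun ω => ?_)
  have e : u ω * v ω - u' ω * v' ω = (u ω - u' ω) * v ω + u' ω * (v ω - v' ω) := by ring
  simp only
  rw [e]
  refine (abs_add_le _ _).trans (add_le_add ?_ ?_)
  · rw [abs_mul, abs_of_nonneg (hv1 ω).1]
    exact mul_le_of_le_one_right (abs_nonneg _) (hv1 ω).2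
  · rw [abs_mul, abs_of_nonneg (hu1' ω).1]
    exact mul_le_of_le_one_left (abs_nonneg _) (hu1' ω).2

theorem abs_integral_sub_le {u v : Ω → ℝ} (hu : Measurable u) (hv : Measurable v)
    (hu1 : ∀ ω, u ω ∈ Set.Icc (0 : ℝ) 1) (hv1 : ∀ ω, v ω ∈ Set.Icc (0 : ℝ) 1) :
    |∫ ω, u ω ∂P - ∫ ω, v ω ∂P| ≤ ∫ ω, |u ω - v ω| ∂P := by
  rw [← integral_sub (integrable_of_mem_Icc hu hu1) (integrable_of_mem_Icc hv hv1)]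
  exact abs_integral_le_integral_abs

end UnitInterval

/-- `f` is a measurable function on `Σ` with values in `[0, 1]` that depends uniformly continuously
on the coordinates in the finite set `I`, and on no others. -/
structure IsUniformCylinder {d : ℕ} (I : Finset (FinVolSet d)) (f : Config d → ℝ) : Prop where
  measurable : Measurable f
  mem_Icc : ∀ π, f π ∈ Set.Icc (0 : ℝ) 1
  uniform : ∀ ε > 0, ∃ δ > 0, ∀ π π' : Config d, (∀ B ∈ I, |π B - π' B| ≤ δ) → |f π - f π'| ≤ ε

theorem IsUniformCylinder.eq_of_eqOn {d : ℕ} {I : Finset (FinVolSet d)} {f : Config d → ℝ}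
    (hf : IsUniformCylinder I f) {π π' : Config d} (h : ∀ B ∈ I, π B = π' B) : f π = f π' := by
  refine eq_of_abs_sub_nonpos (le_of_forall_pos_le_add fun ε hε => ?_)
  obtain ⟨δ, hδ, h'⟩ := hf.uniform ε hε
  rw [zero_add]
  exact h' π π' fun B hB => by rw [h B hB, sub_self, abs_zero]; exact hδ.le

theorem IsUniformCylinder.one_sub {d : ℕ} {I : Finset (FinVolSet d)} {f : Config d → ℝ}
    (hf : IsUniformCylinder I f) : IsUniformCylinder I fun π => 1 - f π where
  measurable := hf.measurable.const_sub 1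
  mem_Icc π := ⟨by linarith [(hf.mem_Icc π).2], by linarith [(hf.mem_Icc π).1]⟩
  uniform ε hε := by
    obtain ⟨δ, hδ, h⟩ := hf.uniform ε hε
    refine ⟨δ, hδ, fun π π' hπ => ?_⟩
    rw [sub_sub_sub_cancel_left, abs_sub_comm]
    exact h π π' hπ

open Classical in
theorem IsUniformCylinder.max {d : ℕ} {I J : Finset (FinVolSet d)} {f g : Config d → ℝ}
    (hf : IsUniformCylinder I f) (hg : IsUniformCylinder J g) :
    IsUniformCylinder (I ∪ J) fun π => max (f π) (g π) where
  measurable := hf.measurable.max hg.measurable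
  mem_Icc π := ⟨le_max_of_le_left (hf.mem_Icc π).1, max_le (hf.mem_Icc π).2 (hg.mem_Icc π).2⟩
  uniform ε hε := by
    obtain ⟨δ, hδ, h⟩ := hf.uniform ε hε
    obtain ⟨δ', hδ', h'⟩ := hg.uniform ε hε
    refine ⟨min δ δ', lt_min hδ hδ', fun π π' hπ => ?_⟩
    refine (abs_max_sub_max_le_max _ _ _ _).trans (max_le (h π π' fun B hB => ?_)
      (h' π π' fun B hB => ?_))
    · exact (hπ B (Finset.mem_union_left _ hB)).trans (min_le_left _ _)
    · exact (hπ B (Finset.mem_union_right _ hB)).trans (min_le_right _ _)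

theorem isUniformCylinder_thickenedIndicator {d : ℕ} (B : FinVolSet d) {δ : ℝ} (hδ : 0 < δ)
    (E : Set ℝ) : IsUniformCylinder {B} fun π => ((thickenedIndicator hδ E (π B) : ℝ≥0) : ℝ) where
  measurable := measurable_coe_nnreal_real.comp
    ((thickenedIndicator hδ E).continuous.measurable.comp (measurable_pi_apply B))
  mem_Icc π := ⟨NNReal.coe_nonneg _, by exact_mod_cast thickenedIndicator_le_one hδ E (π B)⟩
  uniform ε hε := by
    refine ⟨δ * ε, mul_pos hδ hε, fun π π' hπ => ?_⟩
    have h := (lipschitzWith_thickenedIndicator hδ E).dist_le_mul (π B) (π' B)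
    rw [NNReal.dist_eq, Real.dist_eq, NNReal.coe_inv, Real.coe_toNNReal _ hδ.le] at h
    refine h.trans ?_
    rw [inv_mul_le_iff₀ hδ]
    exact hπ B (Finset.mem_singleton_self B)

/-- `S` can be approximated in `L¹(ν)` by uniformly continuous cylinder functions. -/
def IsApproximable {d : ℕ} (ν : Measure (Config d)) (S : Set (Config d)) : Prop :=
  ∀ ε > 0, ∃ (I : Finset (FinVolSet d)) (f : Config d → ℝ), IsUniformCylinder I f ∧
    ∫ π, |S.indicator 1 π - f π| ∂ν ≤ ε

theorem indicator_one_mem_Icc {α : Type*} (S : Set α) (x : α) :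
    S.indicator (1 : α → ℝ) x ∈ Set.Icc (0 : ℝ) 1 := by
  by_cases h : x ∈ S <;> simp [h]

theorem measurable_indicator_one {α : Type*} [MeasurableSpace α] {S : Set α}
    (hS : MeasurableSet S) : Measurable (S.indicator (1 : α → ℝ)) :=
  measurable_one.indicator hS

theorem IsApproximable.compl {d : ℕ} {ν : Measure (Config d)} {S : Set (Config d)} (hS : IsApproximable ν S) :
    IsApproximable ν Sᶜ := by
  intro ε hε
  obtain ⟨I, f, hf, h⟩ := hS ε hε
  refine ⟨I, _, hf.one_sub, le_of_eq_of_le (integral_congr_ae (ae_of_all _ fun π => ?_)) h⟩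
  simp only [Set.indicator_compl, Pi.sub_apply, Pi.one_apply]
  rw [sub_sub_sub_cancel_left, abs_sub_comm]

section Approximation

variable {d : ℕ} {ν : Measure (Config d)} [IsProbabilityMeasure ν]

theorem integrable_abs_indicator_sub {I : Finset (FinVolSet d)} {f : Config d → ℝ}
    (hf : IsUniformCylinder I f) {S : Set (Config d)} (hS : MeasurableSet S) :
    Integrable (fun π => |S.indicator 1 π - f π|) ν :=
  ((integrable_of_mem_Icc (measurable_indicator_one hS) (indicator_one_mem_Icc S)).sub
    (integrable_of_mem_Icc hf.measurable hf.mem_Icc)).abs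

theorem IsApproximable.union {S S' : Set (Config d)} (hS : IsApproximable ν S)
    (hS' : IsApproximable ν S') (mS : MeasurableSet S) (mS' : MeasurableSet S') :
    IsApproximable ν (S ∪ S') := by
  intro ε hε
  obtain ⟨I, f, hf, h⟩ := hS (ε / 2) (half_pos hε)
  obtain ⟨J, g, hg, h'⟩ := hS' (ε / 2) (half_pos hε)
  refine ⟨_, _, hf.max hg, ?_⟩
  have i1 := integrable_abs_indicator_sub (ν := ν) hf mS
  have i2 := integrable_abs_indicator_sub (ν := ν) hg mS'
  calc ∫ π, |(S ∪ S').indicator 1 π - max (f π) (g π)| ∂ν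
      ≤ ∫ π, (|S.indicator 1 π - f π| + |S'.indicator 1 π - g π|) ∂ν := by
        refine integral_mono (integrable_abs_indicator_sub (hf.max hg) (mS.union mS'))
          (i1.add i2) fun π => ?_
        have e : (S ∪ S').indicator (1 : Config d → ℝ) π =
            max (S.indicator 1 π) (S'.indicator 1 π) := by
          by_cases h1 : π ∈ S <;> by_cases h2 : π ∈ S' <;> simp [h1, h2]
        simp only [e]
        exact (abs_max_sub_max_le_max _ _ _ _).trans
          (max_le_add_of_nonneg (abs_nonneg _) (abs_nonneg _))
    _ ≤ ε := by
        rw [integral_add i1 i2]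
        linarith

theorem IsApproximable.of_isClosed (B : FinVolSet d) {E : Set ℝ} (hE : IsClosed E) :
    IsApproximable ν ((fun π : Config d => π B) ⁻¹' E) := by
  intro ε hε
  have hpos : ∀ n : ℕ, 0 < 1 / ((n : ℝ) + 1) := fun n => Nat.one_div_pos_of_nat
  have mS : MeasurableSet ((fun π : Config d => π B) ⁻¹' E) :=
    measurable_pi_apply B hE.measurableSet
  have hlim : Tendsto (fun n : ℕ => ∫ π : Config d,
      |((fun π : Config d => π B) ⁻¹' E).indicator (1 : Config d → ℝ) π -
        ((thickenedIndicator (hpos n) E (π B) : ℝ≥0) : ℝ)| ∂ν) atTop (𝓝 (∫ _, (0 : ℝ) ∂ν)) := by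
    refine tendsto_integral_of_dominated_convergence (fun _ => 1) (fun n =>
      (integrable_abs_indicator_sub (isUniformCylinder_thickenedIndicator B (hpos n) E)
        mS).aestronglyMeasurable) (integrable_const 1) (fun n => ae_of_all _ fun π => ?_)
      (ae_of_all _ fun π => ?_)
    · rw [Real.norm_eq_abs, abs_abs, abs_le]
      have h1 := indicator_one_mem_Icc ((fun π : Config d => π B) ⁻¹' E) π
      have h2 := (isUniformCylinder_thickenedIndicator B (hpos n) E).mem_Icc π
      constructor <;> linarith [h1.1, h1.2, h2.1, h2.2]
    · have h := tendsto_pi_nhds.1 (thickenedIndicator_tendsto_indicator_closure hpos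
        tendsto_one_div_add_atTop_nhds_zero_nat E) (π B)
      rw [hE.closure_eq] at h
      have h' := (((NNReal.continuous_coe.tendsto _).comp h).const_sub
        (((fun π : Config d => π B) ⁻¹' E).indicator (1 : Config d → ℝ) π)).abs
      convert! h' using 2
      by_cases hπ : π B ∈ E <;> simp [hπ]
  rw [integral_zero] at hlim
  obtain ⟨n, hn⟩ := (hlim.eventually (ge_mem_nhds hε)).exists
  exact ⟨_, _, isUniformCylinder_thickenedIndicator B (hpos n) E, hn⟩

theorem IsApproximable.iUnion {S : ℕ → Set (Config d)} (hS : ∀ n, IsApproximable ν (S n))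
    (mS : ∀ n, MeasurableSet (S n)) : IsApproximable ν (⋃ n, S n) := by
  have macc : ∀ n, MeasurableSet (Set.accumulate S n) := fun n =>
    MeasurableSet.biUnion (Set.to_countable _) fun i _ => mS i
  have hacc : ∀ n, IsApproximable ν (Set.accumulate S n) := by
    intro n
    induction n with
    | zero => simpa using hS 0
    | succ n ih =>
      rw [Set.accumulate_succ]
      exact ih.union (hS _) (macc n) (mS _)
  intro ε hε
  have hlim : Tendsto (fun n => ν.real (Set.accumulate S n)) atTop (𝓝 (ν.real (⋃ n, S n))) :=
    (ENNReal.tendsto_toReal (measure_ne_top _ _)).comp tendsto_measure_iUnion_accumulate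
  obtain ⟨n, hn⟩ := (hlim.eventually (lt_mem_nhds (sub_lt_self _ (half_pos hε)))).exists
  obtain ⟨I, f, hf, h⟩ := hacc n (ε / 2) (half_pos hε)
  refine ⟨I, f, hf, ?_⟩
  have mU : MeasurableSet (⋃ n, S n) := MeasurableSet.iUnion mS
  have hsub : Set.accumulate S n ⊆ ⋃ n, S n := Set.accumulate_subset_iUnion n
  have mD := mU.diff (macc n)
  have i1 := integrable_abs_indicator_sub (ν := ν) hf (macc n)
  have i2 : Integrable (((⋃ n, S n) \ Set.accumulate S n).indicator (1 : Config d → ℝ)) ν :=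
    integrable_of_mem_Icc (measurable_indicator_one mD) (indicator_one_mem_Icc _)
  calc ∫ π, |(⋃ n, S n).indicator 1 π - f π| ∂ν
      ≤ ∫ π, (|(Set.accumulate S n).indicator 1 π - f π| +
          ((⋃ n, S n) \ Set.accumulate S n).indicator (1 : Config d → ℝ) π) ∂ν := by
        refine integral_mono (integrable_abs_indicator_sub hf mU) (i1.add i2) fun π => ?_
        simp only [Set.indicator_sdiff hsub, Pi.sub_apply]
        have h0 : (Set.accumulate S n).indicator (1 : Config d → ℝ) π ≤
            (⋃ n, S n).indicator (1 : Config d → ℝ) π :=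
          Set.indicator_le_indicator_of_subset hsub (fun _ => zero_le_one) π
        rw [← abs_of_nonneg (sub_nonneg.2 h0), add_comm]
        refine le_of_eq_of_le ?_ (abs_add_le _ _)
        congr 1
        ring
    _ ≤ ε := by
        rw [integral_add i1 i2, integral_indicator_one mD,
          measureReal_sdiff hsub (macc n)]
        linarith

/-- The approximable measurable sets form a `σ`-field, and it contains the preimages of closed sets
under the coordinates. -/
theorem isApproximable_of_measurableSet {S : Set (Config d)} (hS : MeasurableSet S) :
    IsApproximable ν S := by
  let m : MeasurableSpace (Config d) :=
    { MeasurableSet' := fun S => MeasurableSet S ∧ IsApproximable ν S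
      measurableSet_empty := ⟨MeasurableSet.empty, by
        have h := IsApproximable.of_isClosed (ν := ν) (⟨∅, by simp⟩ : FinVolSet d) isClosed_empty
        simpa using h⟩
      measurableSet_compl := fun S h => ⟨h.1.compl, h.2.compl⟩
      measurableSet_iUnion := fun S h => ⟨MeasurableSet.iUnion fun n => (h n).1,
        IsApproximable.iUnion (fun n => (h n).2) fun n => (h n).1⟩ }
  have hle : (MeasurableSpace.pi : MeasurableSpace (Config d)) ≤ m := by
    refine iSup_le fun B => ?_
    rw [← measurable_iff_comap_le]
    exact @measurable_of_isClosed _ _ _ _ _ m _ fun E hE =>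
      ⟨measurable_pi_apply B hE.measurableSet, IsApproximable.of_isClosed B hE⟩
  exact (hle S hS).2

end Approximation

/-! ### Asymptotic independence and the zero-one law -/

variable {Ω : Type*} [MeasurableSpace Ω] {d : ℕ} {μ : Measure ℝ} {P : Measure Ω}
  {X : FinVolSet d → Ω → ℝ}

theorem IsLevyNoise.measurable_path (hX : IsLevyNoise d μ P X) :
    Measurable (path X) :=
  measurable_pi_lambda _ fun B => hX.measurable B

theorem measurable_T (g : Gam d) : Measurable (T g) :=
  measurable_pi_lambda _ fun _ => measurable_pi_apply _

/-- Uniformly continuous cylinder functions of two noises that live on disjoint regions are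
uncorrelated. The second one is read off from a relabelled family `B ↦ X (D B)`. -/
theorem IsLevyNoise.integral_mul_eq (hX : IsLevyNoise d μ P X) {I : Finset (FinVolSet d)}
    {f : Config d → ℝ} (hf : IsUniformCylinder I f) (D : FinVolSet d → FinVolSet d)
    (hD : ∀ B ∈ I, ∀ C ∈ I, Disjoint (B : Set (Fin d → ℝ)) (D C)) :
    ∫ ω, f (path X ω) * f (path (fun B => X (D B)) ω) ∂P =
      (∫ ω, f (path X ω) ∂P) * ∫ ω, f (path (fun B => X (D B)) ω) ∂P := by
  classical
  let e : (I → ℝ) → Config d := fun y B => if h : B ∈ I then y ⟨B, h⟩ else 0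
  have he : Measurable e := by
    refine measurable_pi_lambda _ fun B => ?_
    by_cases h : B ∈ I
    · simpa [e, h] using measurable_pi_apply (X := fun _ : I => ℝ) ⟨B, h⟩
    · simp [e, h]
  have hfe : ∀ π : Config d, f (e fun B : I => π B) = f π := fun π =>
    hf.eq_of_eqOn fun B hB => by simp [e, hB]
  have hind := (hX.indepFun_of_disjoint (fun B : I => (B : FinVolSet d)) (fun B : I => D B)
    fun B C => hD B B.2 C C.2).comp (hf.measurable.comp he) (hf.measurable.comp he)
  have h1 : ((f ∘ e) ∘ fun ω (B : I) => X B ω) = fun ω => f (path X ω) :=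
    funext fun ω => hfe (path X ω)
  have h2 : ((f ∘ e) ∘ fun ω (B : I) => X (D B) ω) = fun ω => f (path (fun B => X (D B)) ω) :=
    funext fun ω => hfe (path (fun B => X (D B)) ω)
  rw [h1, h2] at hind
  exact hind.integral_fun_mul_eq_mul_integral
    (hf.measurable.comp hX.measurable_path).aestronglyMeasurable
    (hf.measurable.comp (measurable_pi_lambda _ fun B => hX.measurable (D B))).aestronglyMeasurable

/-- Removing pieces `E B` of small volume from the sets `F B` changes a uniformly continuous cylinder
function of the noise of these sets little in `L¹`, because the noise of a set of small volume is
small with high probability. -/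
theorem IsLevyNoise.exists_integral_abs_sub_le [IsProbabilityMeasure P]
    (hX : IsLevyNoise d μ P X) {I : Finset (FinVolSet d)} {f : Config d → ℝ} (hf : IsUniformCylinder I f) {ε : ℝ}
    (hε : 0 < ε) :
    ∃ η : ℝ≥0∞, η ≠ 0 ∧ ∀ D E F : FinVolSet d → FinVolSet d,
      (∀ B ∈ I, Disjoint (D B : Set (Fin d → ℝ)) (E B) ∧
        (F B : Set (Fin d → ℝ)) = (D B : Set (Fin d → ℝ)) ∪ (E B : Set (Fin d → ℝ)) ∧
        volume (E B : Set (Fin d → ℝ)) ≤ η) →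
      ∫ ω, |f (path (fun B => X (F B)) ω) - f (path (fun B => X (D B)) ω)| ∂P ≤ ε := by
  obtain ⟨κ, hκ, hlaw⟩ := hX.law
  obtain ⟨δ, hδ, huni⟩ := hf.uniform (ε / 2) (half_pos hε)
  -- `+ 1` because `I` may be empty
  let ε' : ℝ := ε / 2 / (I.card + 1)
  have hε' : 0 < ε' := by positivity
  obtain ⟨η, hη, hsmall⟩ := hκ.exists_tail_le hδ (ENNReal.ofReal_pos.2 hε').ne'
  refine ⟨η, by exact_mod_cast hη.ne', fun D E F h => ?_⟩
  -- off the event `N` the arguments of `f` differ by at most `δ` in the coordinates of `I`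
  let N : Set Ω := ⋃ B ∈ I, {ω | δ < |X (E B) ω|}
  have mN : MeasurableSet N := Finset.measurableSet_biUnion I fun B _ =>
    measurableSet_lt measurable_const (hX.measurable _).abs
  have hN : P.real N ≤ ε / 2 := by
    have h1 : ∀ B ∈ I, P.real {ω | δ < |X (E B) ω|} ≤ ε' := by
      intro B hB
      have hm : MeasurableSet {x : ℝ | δ < |x|} :=
        measurableSet_lt measurable_const measurable_id.abs
      have h2 : P {ω | δ < |X (E B) ω|} ≤ ENNReal.ofReal ε' := by
        have h3 := hsmall _ ((ENNReal.toNNReal_mono ENNReal.coe_ne_top (h B hB).2.2).trans_eq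
          (ENNReal.toNNReal_coe η))
        rwa [← hlaw, Measure.map_apply (hX.measurable _) hm] at h3
      exact ENNReal.toReal_le_of_le_ofReal hε'.le h2
    refine (measureReal_biUnion_finset_le I _).trans ((Finset.sum_le_sum h1).trans ?_)
    rw [Finset.sum_const, nsmul_eq_mul]
    have h4 : ((I.card : ℝ) + 1) * ε' = ε / 2 := by
      simp only [ε']
      field_simp
    nlinarith
  have hae : ∀ᵐ ω ∂P, ∀ B ∈ I, X (F B) ω = X (D B) ω + X (E B) ω := by
    refine (ae_ball_iff I.countable_toSet).2 fun B hB => ?_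
    have hpair : Pairwise fun i j : Bool =>
        Disjoint ((bif i then D B else E B : FinVolSet d) : Set (Fin d → ℝ))
          (bif j then D B else E B : FinVolSet d) := by
      rintro (_ | _) (_ | _) hij
      · exact absurd rfl hij
      · exact (h B hB).1.symm
      · exact (h B hB).1
      · exact absurd rfl hij
    have hun : (F B : Set (Fin d → ℝ)) =
        ⋃ i : Bool, ((bif i then D B else E B : FinVolSet d) : Set (Fin d → ℝ)) := by
      rw [(h B hB).2.1, Set.union_eq_iUnion]
      exact Set.iUnion_congr fun i => by cases i <;> rfl
    filter_upwards [hX.ae_eq_sum hpair hun] with ω hω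
    rw [hω]
    simp
  have mF : ∀ D : FinVolSet d → FinVolSet d,
      Measurable fun ω => f (path (fun B => X (D B)) ω) := fun D =>
    hf.measurable.comp (measurable_pi_lambda _ fun B => hX.measurable (D B))
  have hi : Integrable (fun ω =>
      |f (path (fun B => X (F B)) ω) - f (path (fun B => X (D B)) ω)|) P :=
    ((integrable_of_mem_Icc (mF F) fun ω => hf.mem_Icc _).sub
      (integrable_of_mem_Icc (mF D) fun ω => hf.mem_Icc _)).abs
  have hiN : Integrable (N.indicator (1 : Ω → ℝ)) P :=
    integrable_of_mem_Icc (measurable_indicator_one mN) (indicator_one_mem_Icc N)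
  calc ∫ ω, |f (path (fun B => X (F B)) ω) - f (path (fun B => X (D B)) ω)| ∂P
      ≤ ∫ ω, (ε / 2 + N.indicator (1 : Ω → ℝ) ω) ∂P := by
        refine integral_mono_ae hi ((integrable_const _).add hiN) ?_
        filter_upwards [hae] with ω hω
        by_cases hωN : ω ∈ N
        · rw [Set.indicator_of_mem hωN, Pi.one_apply, abs_le]
          have h1 := hf.mem_Icc (path (fun B => X (F B)) ω)
          have h2 := hf.mem_Icc (path (fun B => X (D B)) ω)
          constructor <;> linarith [h1.1, h1.2, h2.1, h2.2]
        · rw [Set.indicator_of_notMem hωN, add_zero]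
          refine huni _ _ fun B hB => ?_
          have h1 : ¬ δ < |X (E B) ω| := fun h2 => hωN (Set.mem_biUnion hB h2)
          simpa [path, hω B hB] using h1
    _ ≤ ε := by
        rw [integral_add (integrable_const _) hiN, integral_indicator_one mN, integral_const,
          probReal_univ, one_smul]
        linarith

theorem IsLevyNoise.integral_T_path_eq [IsProbabilityMeasure P]
    (hX : IsLevyNoise d μ P X) (g : Gam d) {h : Config d → ℝ}
    (hh : Measurable h) : ∫ ω, h (T g (path X ω)) ∂P = ∫ ω, h (path X ω) ∂P := by
  rw [← integral_map (hX.measurable_path).aemeasurable hh.aestronglyMeasurable,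
    ← hX.map_T_path_eq g]
  exact (integral_map ((measurable_T g).comp hX.measurable_path).aemeasurable
    hh.aestronglyMeasurable).symm

/-- Along a non-compact closed group, cylinder functions become asymptotically uncorrelated. -/
theorem IsLevyNoise.exists_abs_integral_mul_sub_le [IsProbabilityMeasure P]
    (hX : IsLevyNoise d μ P X) {G : Subgroup (Gam d)} (hG : IsClosed (G : Set (Gam d)))
    (hnc : ¬ IsCompact (G : Set (Gam d))) {I : Finset (FinVolSet d)} {f : Config d → ℝ}
    (hf : IsUniformCylinder I f) {ε : ℝ} (hε : 0 < ε) :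
    ∃ g ∈ G, |∫ ω, f (path X ω) * f (T g (path X ω)) ∂P - (∫ ω, f (path X ω) ∂P) ^ 2| ≤ ε := by
  obtain ⟨η, hη, hstab⟩ := hX.exists_integral_abs_sub_le hf (half_pos hε)
  let U : Set (Fin d → ℝ) := ⋃ B ∈ I, (B : Set (Fin d → ℝ))
  have mU : MeasurableSet U := Finset.measurableSet_biUnion I fun B _ => B.2.1
  have hUfin : volume U < ∞ := (measure_biUnion_finset_le I _).trans_lt
    (ENNReal.sum_lt_top.2 fun B _ => B.2.2)
  have hBU : ∀ B ∈ I, (B : Set (Fin d → ℝ)) ⊆ U := fun B hB => Set.subset_biUnion_of_mem hB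
  obtain ⟨g, hgG, hg⟩ := exists_volume_preimage_inter_le hG hnc mU hUfin hη
  refine ⟨g, hgG, ?_⟩
  let F : FinVolSet d → FinVolSet d := FinVolSet.invImage g
  let D : FinVolSet d → FinVolSet d := fun B => ⟨F B \ U, (F B).2.1.diff mU,
    (measure_mono Set.sdiff_subset).trans_lt (F B).2.2⟩
  let E : FinVolSet d → FinVolSet d := fun B => ⟨F B ∩ U, (F B).2.1.inter mU,
    (measure_mono Set.inter_subset_left).trans_lt (F B).2.2⟩
  have hstab' := hstab D E F fun B hB => ⟨Set.disjoint_sdiff_inter,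
    (Set.sdiff_union_inter _ _).symm,
    (measure_mono (Set.inter_subset_inter_left _ (Set.preimage_mono (hBU B hB)))).trans hg⟩
  have hind := hX.integral_mul_eq hf D fun B hB C _ =>
    Set.disjoint_left.2 fun x hx hx' => hx'.2 (hBU B hB hx)
  have hinv := hX.integral_T_path_eq g hf.measurable
  have mu : Measurable fun ω => f (path X ω) := hf.measurable.comp hX.measurable_path
  have mv : Measurable fun ω => f (T g (path X ω)) :=
    hf.measurable.comp ((measurable_T g).comp hX.measurable_path)
  have mw : Measurable fun ω => f (path (fun B => X (D B)) ω) :=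
    hf.measurable.comp (measurable_pi_lambda _ fun B => hX.measurable (D B))
  change ∫ ω, |f (T g (path X ω)) - f (path (fun B => X (D B)) ω)| ∂P ≤ ε / 2 at hstab'
  have h1 := abs_integral_mul_sub_le (P := P) mu mv mu mw (fun ω => hf.mem_Icc _)
    (fun ω => hf.mem_Icc _) (fun ω => hf.mem_Icc _) fun ω => hf.mem_Icc _
  have h2 := abs_integral_sub_le (P := P) mv mw (fun ω => hf.mem_Icc _) fun ω => hf.mem_Icc _
  simp only [sub_self, abs_zero, integral_zero, zero_add] at h1
  have h0 : 0 ≤ ∫ ω, f (path X ω) ∂P := integral_nonneg fun ω => (hf.mem_Icc _).1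
  have h0' : ∫ ω, f (path X ω) ∂P ≤ 1 := by
    refine (integral_mono (integrable_of_mem_Icc mu fun ω => hf.mem_Icc _)
      (integrable_const (1 : ℝ)) fun ω => (hf.mem_Icc _).2).trans_eq ?_
    simp
  rw [hind] at h1
  rw [hinv] at h2
  set p := ∫ ω, f (path X ω) ∂P
  have h3 : |p * ∫ ω, f (path (fun B => X (D B)) ω) ∂P - p ^ 2| ≤ ε / 2 := by
    rw [sq, ← mul_sub, abs_mul, abs_of_nonneg h0, abs_sub_comm]
    exact (mul_le_of_le_one_left (abs_nonneg _) h0').trans (h2.trans hstab')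
  refine (abs_sub_le _ _ _).trans ((add_le_add (h1.trans hstab') h3).trans_eq (add_halves ε))

theorem IsLevyNoise.zero_or_one_of_not_isCompact [IsProbabilityMeasure P]
    (hX : IsLevyNoise d μ P X) {G : Subgroup (Gam d)} (hG : IsClosed (G : Set (Gam d)))
    (hnc : ¬ IsCompact (G : Set (Gam d))) {S : Set (Config d)}
    (hS : MeasurableSet[invariantSigmaField P X G] S) :
    P {ω | path X ω ∈ S} = 0 ∨ P {ω | path X ω ∈ S} = 1 := by
  obtain ⟨mS, hinv⟩ : MeasurableSet S ∧ ∀ g ∈ G,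
    P (symmDiff {ω | path X ω ∈ S} {ω | T g (path X ω) ∈ S}) = 0 := hS
  have hm := hX.measurable_path
  have hprob : IsProbabilityMeasure (P.map (path X)) :=
    Measure.isProbabilityMeasure_map hm.aemeasurable
  have mA : MeasurableSet {ω | path X ω ∈ S} := hm mS
  have mχ : Measurable (S.indicator (1 : Config d → ℝ)) := measurable_indicator_one mS
  set p := P.real {ω | path X ω ∈ S} with hp
  have hp0 : 0 ≤ p := measureReal_nonneg
  have hp1 : p ≤ 1 := measureReal_le_one
  have hpint : ∫ ω, S.indicator (1 : Config d → ℝ) (path X ω) ∂P = p := by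
    rw [hp, ← integral_indicator_one mA]
    rfl
  have key : ∀ ε > 0, |p - p ^ 2| ≤ 6 * ε := by
    intro ε hε
    obtain ⟨I, f, hf, hfS⟩ := isApproximable_of_measurableSet (ν := P.map (path X)) mS ε hε
    have mh : Measurable fun π => |S.indicator (1 : Config d → ℝ) π - f π| :=
      (mχ.sub hf.measurable).abs
    rw [integral_map hm.aemeasurable mh.aestronglyMeasurable] at hfS
    obtain ⟨g, hgG, hg⟩ := hX.exists_abs_integral_mul_sub_le hG hnc hf hε
    have hfS' := (hX.integral_T_path_eq g mh).trans_le hfS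
    have hmT := (measurable_T g).comp hm
    have h1 := abs_integral_mul_sub_le (P := P) (mχ.comp hm) (mχ.comp hmT) (hf.measurable.comp hm)
      (hf.measurable.comp hmT) (fun ω => indicator_one_mem_Icc _ _)
      (fun ω => indicator_one_mem_Icc _ _) (fun ω => hf.mem_Icc _) fun ω => hf.mem_Icc _
    have h2 := abs_integral_sub_le (P := P) (mχ.comp hm) (hf.measurable.comp hm)
      (fun ω => indicator_one_mem_Icc _ _) fun ω => hf.mem_Icc _
    simp only [Function.comp_apply] at h1 h2
    -- invariance makes the product of the two indicators almost surely equal to the first one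
    have h3 : ∫ ω, S.indicator (1 : Config d → ℝ) (path X ω) *
        S.indicator (1 : Config d → ℝ) (T g (path X ω)) ∂P = p := by
      rw [← hpint]
      refine integral_congr_ae ?_
      filter_upwards [(measure_symmDiff_eq_zero_iff.1 (hinv g hgG)).mem_iff] with ω hω
      change path X ω ∈ S ↔ T g (path X ω) ∈ S at hω
      by_cases h : path X ω ∈ S
      · simp [h, hω.1 h]
      · simp [h]
    rw [h3] at h1
    rw [hpint] at h2
    have hq0 : 0 ≤ ∫ ω, f (path X ω) ∂P := integral_nonneg fun ω => (hf.mem_Icc _).1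
    have hq1 : ∫ ω, f (path X ω) ∂P ≤ 1 := by
      refine (integral_mono (integrable_of_mem_Icc (hf.measurable.comp hm) fun ω => hf.mem_Icc _)
        (integrable_const (1 : ℝ)) fun ω => (hf.mem_Icc _).2).trans_eq ?_
      simp
    set q := ∫ ω, f (path X ω) ∂P
    have h4 : |q ^ 2 - p ^ 2| ≤ 2 * ε := by
      rw [sq_sub_sq, abs_mul, abs_of_nonneg (add_nonneg hq0 hp0), abs_sub_comm]
      exact mul_le_mul (by linarith) (h2.trans hfS) (abs_nonneg _) zero_le_two
    have h5 := abs_sub_le p (∫ ω, f (path X ω) * f (T g (path X ω)) ∂P) (p ^ 2)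
    have h6 := abs_sub_le (∫ ω, f (path X ω) * f (T g (path X ω)) ∂P) (q ^ 2) (p ^ 2)
    linarith
  have hpp : p - p ^ 2 = 0 := by
    refine abs_nonpos_iff.1 (le_of_forall_pos_le_add fun ε hε => ?_)
    have := key (ε / 6) (by positivity)
    linarith
  have hfac : p * (1 - p) = 0 := by linarith [sq p]
  rcases mul_eq_zero.1 hfac with h | h
  · exact Or.inl ((measureReal_eq_zero_iff (measure_ne_top _ _)).1 h)
  · right
    rw [← ENNReal.toReal_eq_one_iff]
    exact (sub_eq_zero.1 h).symm

/-- For a compact group, the noise of an invariant set of volume at least `1` is a non-degenerate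
invariant random variable. -/
theorem IsLevyNoise.exists_nontrivial_of_isCompact (hX : IsLevyNoise d μ P X)
    (hμ : ∀ c : ℝ, μ ≠ Measure.dirac c) {G : Subgroup (Gam d)}
    (hc : IsCompact (G : Set (Gam d))) :
    ∃ S : Set (Config d), MeasurableSet[invariantSigmaField P X G] S ∧
      P {ω | path X ω ∈ S} ≠ 0 ∧ P {ω | path X ω ∈ S} ≠ 1 := by
  obtain ⟨κ, hκ, hlaw⟩ := hX.law
  obtain ⟨B, hB, hball, hinv⟩ := exists_invariant_compact hc
  let C : FinVolSet d := ⟨B, hB.measurableSet, hB.measure_lt_top⟩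
  have hvol : 1 ≤ (volume (C : Set (Fin d → ℝ))).toNNReal := by
    have h1 : (1 : ℝ≥0∞) ≤ volume B := by
      refine le_trans ?_ (measure_mono hball)
      rw [Real.volume_pi_closedBall _ zero_le_one, ← ENNReal.ofReal_one]
      refine ENNReal.ofReal_le_ofReal ?_
      rw [mul_one]
      exact one_le_pow₀ one_le_two
    exact ENNReal.toNNReal_mono hB.measure_lt_top.ne h1
  obtain ⟨A, mA, hA0, hA1⟩ := hκ.exists_nontrivial_event hμ hvol
  rw [← hlaw, Measure.map_apply (hX.measurable _) mA] at hA0 hA1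
  refine ⟨(fun π : Config d => π C) ⁻¹' A, ⟨measurable_pi_apply C mA, fun g hg => ?_⟩, hA0, hA1⟩
  have hC : FinVolSet.invImage g C = C := Subtype.ext (hinv g hg)
  have hT : ∀ π : Config d, T g π C = π C := fun π => congrArg π hC
  simp only [Set.mem_preimage, hT, symmDiff_self]
  exact measure_empty

end LevyNoise

theorem theorem1 (d : ℕ) (hd : 2 ≤ d)
    (μ : Measure ℝ) [IsProbabilityMeasure μ] (hdiv : LevyNoise.IsInfinitelyDivisible μ)
    (hμ : ∀ c : ℝ, μ ≠ Measure.dirac c)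
    {Ω : Type*} [MeasurableSpace Ω] (P : Measure Ω) [IsProbabilityMeasure P]
    (X : LevyNoise.FinVolSet d → Ω → ℝ) (hX : LevyNoise.IsLevyNoise d μ P X)
    (G : Subgroup (LevyNoise.Gam d)) (hG : IsClosed (G : Set (LevyNoise.Gam d))) :
    (∀ S : Set (LevyNoise.Config d),
        MeasurableSet[LevyNoise.invariantSigmaField P X G] S →
          P {ω | LevyNoise.path X ω ∈ S} = 0 ∨ P {ω | LevyNoise.path X ω ∈ S} = 1) ↔
      ¬ IsCompact (G : Set (LevyNoise.Gam d)) := by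
  constructor
  · intro h hc
    obtain ⟨S, hS, h0, h1⟩ := hX.exists_nontrivial_of_isCompact hμ hc
    exact (h S hS).elim h0 h1
  · exact fun hnc S hS => hX.zero_or_one_of_not_isCompact hG hnc hS
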